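/- Let $X=(X_{ij})_{i,j\ge 1}$ be an array of i.i.d. real random variables such that $\mathbb{E}\exp(c|X_{ij}|)<\infty$ for some $c>0$, $\mathbb{E}X_{ij}=0$, $\mathbb{E}X_{ij}^2=1$ and $\gamma:=\mathbb{E}X_{ij}^3\neq 0$. Let $d=d_n$ be positive integers depending on $n$ such that $(\log^3 d)/n\to 0$ and $d(\log^3 d)/n\to\infty$ as $n\to\infty$. For every $n$ put $W=W^{(n)}=n^{-1/2}\sum_{i=1}^n X_i$ with $X_i=(X_{i1},\dots,X_{id})^\top\in\mathbb{R}^d$, and let $Z=Z^{(n)}\sim N(0,I_d)$ be a standard Gaussian vector in $\mathbb{R}^d$. Then there exists a sequence $(x_n)$ of positive numbers such that $x_n=o(n^{1/6})$ as $n\to\infty$ and \[ \limsup_{n\to\infty}\sqrt{\frac{n}{x_n^6+\log^3(dn)}}\left|\frac{P\left(\max_{1\le j\le d}W_j>x_n\right)}{P\left(\max_{1\le j\le d}Z_j>x_n\right)}-1\right|>0, \] where the limsup is taken in $[0,\infty]$. -/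

import Mathlib

open MeasureTheory ProbabilityTheory Filter Topology Asymptotics

noncomputable section

/-- The `i`-th row of the array `X`, truncated to its first `d` entries, as a random vector in `ℝ^d`.
Rows and columns of the array are numbered from `0`. -/
def rowVector {Ω : Type*} (X : ℕ → ℕ → Ω → ℝ) (d i : ℕ) (ω : Ω) : EuclideanSpace ℝ (Fin d) :=
  WithLp.toLp 2 fun j => X i j ω

/-- The normalized sum `n^{-1/2} (X_1 + ⋯ + X_n)` of the first `n` rows, truncated to `ℝ^d`. -/
def normalizedSum {Ω : Type*} (X : ℕ → ℕ → Ω → ℝ) (n d : ℕ) (ω : Ω) : EuclideanSpace ℝ (Fin d) :=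
  (Real.sqrt n)⁻¹ • ∑ i ∈ Finset.range n, rowVector X d i ω

/-- The largest coordinate of a vector of `ℝ^d` (for `d ≥ 1`). -/
def maxCoord {d : ℕ} (v : EuclideanSpace ℝ (Fin d)) : ℝ :=
  ⨆ j : Fin d, v j

end

/-! A nonzero third moment shows up in the exponential moments. With `l` the test point and `r = l ^
3 / √n`, the cumulant generating function of one coordinate of `W` at `l` is `l ^ 2 / 2 + γ * r / 6`
up to a small fraction of `|γ| * r`, so the exponential moment differs from the Gaussian one by a
factor of about `exp (γ * r / 6)`. The claim is that tails of maxima which are too close to Gaussian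
would rule this out.

Coordinates are independent, so a maximum exceeds `x` with probability `1 - (1 - p) ^ d`, where `p`
is the tail of one coordinate. This equals `d * p` up to a factor at least `1 - d * p`. An
exponential moment at `l` is an integral of `p` against `l * exp (l * x)`, essentially carried by
`[l / 2, 2 * l]`. Hence if the ratio of the tails of the maxima stayed within `u` of `1` there, and
`d * p` were at most `u`, the exponential moments would agree up to a factor `1 + O(u)`; for `u =
|γ| * r / 100` this is a contradiction (`exists_max_tail_deviation`). Some `x` in `[l / 2, 2 * l]`
therefore has relative error at least `u`.

The scale must satisfy two demands: `l = o(n ^ (1 / 6))`, and `l ^ 2` large against `log (d n)`, so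
that `d * p` is negligible. Taking `l ^ 6` to be the geometric mean of `n` and `L = √n + log (d n) ^
3` meets both, because `L / n → 0`; the summand `√n` keeps `L ≥ 1`. Then `x ^ 6 + log (d n) ^ 3` is
`O(l ^ 6)`, and the normalizing factor cancels `r`. -/

/-! ### Tails of maxima of independent coordinates -/

/-- The columns of an array of independent random variables are independent. -/
lemma iIndepFun_columns {Ω ι κ : Type*} [MeasurableSpace Ω] {P : Measure Ω}
    {X : ι → κ → Ω → ℝ} (hX : ∀ i j, Measurable (X i j))
    (h : iIndepFun (fun p : ι × κ => X p.1 p.2) P) :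
    iIndepFun (fun j ω i => X i j ω) P := by
  have hP := h.isProbabilityMeasure
  have hlaw : ∀ j i, IsProbabilityMeasure (P.map (X i j)) :=
    fun j i => Measure.isProbabilityMeasure_map (hX i j).aemeasurable
  have hcol : ∀ j, iIndepFun (fun i => X i j) P := fun j =>
    h.precomp (g := fun i => (i, j)) fun a b hab => (Prod.ext_iff.1 hab).1
  -- Listing the column index first lets currying turn the product law of the array into a product
  -- over columns of product laws.
  have hsigma : iIndepFun (fun p : (_ : κ) × ι => X p.2 p.1) P :=
    h.precomp (g := fun p : (_ : κ) × ι => (p.2, p.1)) fun a b hab => by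
      cases a; cases b; simp_all
  have hcurry : (MeasurableEquiv.piCurry fun (_ : κ) (_ : ι) => ℝ) ∘
      (fun ω (p : (_ : κ) × ι) => X p.2 p.1 ω) = fun ω j i => X i j ω := by
    ext; simp [Sigma.curry]
  rw [iIndepFun_iff_map_fun_eq_infinitePi_map (by fun_prop)] at hsigma ⊢
  rw [← hcurry, ← Measure.map_map (by fun_prop) (by fun_prop), hsigma,
    Measure.infinitePi_map_piCurry (fun j i => P.map (X i j))]
  congr with j : 1
  exact ((iIndepFun_iff_map_fun_eq_infinitePi_map fun i => hX i j).1 (hcol j)).symm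

/-- The upper tail of the maximum of independent random variables with a common upper tail. -/
lemma measureReal_lt_iSup_of_iIndepFun {Ω ι : Type*} [MeasurableSpace Ω] [Fintype ι] [Nonempty ι]
    {P : Measure Ω} {Y : ι → Ω → ℝ} (hY : ∀ j, Measurable (Y j)) (h : iIndepFun Y P) {x p : ℝ}
    (hp : ∀ j, P.real {ω | x < Y j ω} = p) :
    P.real {ω | x < ⨆ j, Y j ω} = 1 - (1 - p) ^ Fintype.card ι := by
  have hP := h.isProbabilityMeasure
  have hset : {ω | x < ⨆ j, Y j ω} = (⋂ j ∈ Finset.univ, Y j ⁻¹' Set.Iic x)ᶜ := by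
    ext ω
    simp only [Set.mem_ofPred_eq, Set.mem_compl_iff, Set.mem_iInter, Finset.mem_univ,
      Set.mem_preimage, Set.mem_Iic, forall_const]
    rw [← ciSup_le_iff (Set.finite_range _).bddAbove, not_le]
  have hmeas : MeasurableSet (⋂ j ∈ Finset.univ, Y j ⁻¹' Set.Iic x) :=
    Finset.measurableSet_biInter _ fun j _ => hY j measurableSet_Iic
  have hprod := (iIndepFun_iff_measure_inter_preimage_eq_mul.1 h) Finset.univ
    (sets := fun _ => Set.Iic x) fun _ _ => measurableSet_Iic
  rw [hset, probReal_compl_eq_one_sub hmeas, measureReal_def, hprod, ENNReal.toReal_prod]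
  congr 1
  rw [Finset.prod_eq_pow_card (b := 1 - p), Finset.card_univ]
  intro j _
  rw [← hp j, ← probReal_compl_eq_one_sub (measurableSet_lt measurable_const (hY j)), measureReal_def]
  congr 2
  ext ω; simp

/-- The upper tail of the maximal coordinate of a standard Gaussian vector. -/
lemma measureReal_lt_maxCoord_gaussian {Ω : Type*} [MeasurableSpace Ω] {P : Measure Ω} {d : ℕ}
    (hd : d ≠ 0) {Z : Ω → EuclideanSpace ℝ (Fin d)} (hZ : HasLaw Z (multivariateGaussian 0 1) P)
    (x : ℝ) :
    P.real {ω | x < maxCoord (Z ω)} = 1 - (1 - (gaussianReal 0 1).real (Set.Ioi x)) ^ d := by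
  have : Nonempty (Fin d) := ⟨⟨0, Nat.pos_of_ne_zero hd⟩⟩
  have hmeas : MeasurableSet {v : EuclideanSpace ℝ (Fin d) | x < maxCoord v} := by
    unfold maxCoord
    exact measurableSet_lt measurable_const (Measurable.iSup fun j => by fun_prop)
  have h1 : P.real {ω | x < maxCoord (Z ω)} =
      (Measure.pi fun _ : Fin d => gaussianReal 0 1).real {y | x < ⨆ j, y j} := by
    rw [measureReal_def, measureReal_def]
    change (P (Z ⁻¹' {v | x < maxCoord v})).toReal = _
    rw [← Measure.map_apply_of_aemeasurable hZ.aemeasurable hmeas, hZ.map_eq,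
      multivariateGaussian_zero_one, ← map_pi_eq_stdGaussian,
      Measure.map_apply (by fun_prop) hmeas]
    rfl
  rw [h1, measureReal_lt_iSup_of_iIndepFun (Y := fun j (y : Fin d → ℝ) => y j)
    (p := (gaussianReal 0 1).real (Set.Ioi x)) (fun j => by fun_prop)
    (iIndepFun_pi (X := fun _ y => y) fun _ => by fun_prop) fun j => ?_, Fintype.card_fin]
  exact (measurePreserving_eval (fun _ : Fin d => gaussianReal 0 1) j).measureReal_preimage
    measurableSet_Ioi.nullMeasurableSet

/-- The upper tail of the maximal coordinate of the normalized sum of i.i.d. rows with i.i.d.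
entries. -/
lemma measureReal_lt_maxCoord_normalizedSum {Ω : Type*} [MeasurableSpace Ω] {P : Measure Ω}
    {X : ℕ → ℕ → Ω → ℝ} (hmeas : ∀ i j, Measurable (X i j))
    (hindep : iIndepFun (fun p : ℕ × ℕ => X p.1 p.2) P)
    (hident : ∀ i j, IdentDistrib (X i j) (X 0 0) P P) (n : ℕ) {d : ℕ} (hd : d ≠ 0) (x : ℝ) :
    P.real {ω | x < maxCoord (normalizedSum X n d ω)} =
      1 - (1 - (P.map fun ω => (Real.sqrt n)⁻¹ * ∑ i ∈ Finset.range n, X i 0 ω).real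
        (Set.Ioi x)) ^ d := by
  have : Nonempty (Fin d) := ⟨⟨0, Nat.pos_of_ne_zero hd⟩⟩
  have hP := hindep.isProbabilityMeasure
  let g : (ℕ → ℝ) → ℝ := fun u => (Real.sqrt n)⁻¹ * ∑ i ∈ Finset.range n, u i
  have hg : Measurable g := by fun_prop
  have hmax : ∀ ω, maxCoord (normalizedSum X n d ω) = ⨆ j : Fin d, g (fun i => X i j ω) := by
    intro ω
    simp [maxCoord, normalizedSum, rowVector, g]
  have hcol : ∀ j, iIndepFun (fun i => X i j) P := fun j =>
    hindep.precomp (g := fun i => (i, j)) fun a b hab => (Prod.ext_iff.1 hab).1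
  have hid : ∀ j, IdentDistrib (fun ω => g fun i => X i j ω) (fun ω => g fun i => X i 0 ω) P P :=
    fun j => (IdentDistrib.pi (fun i => (hident i j).trans (hident i 0).symm)
      (hcol j) (hcol 0)).comp hg
  simp_rw [hmax]
  rw [measureReal_lt_iSup_of_iIndepFun (Y := fun (j : Fin d) ω => g fun i => X i j ω)
    (fun j => by fun_prop)
    (((iIndepFun_columns hmeas hindep).precomp Fin.val_injective).comp (fun _ => g) fun _ => hg)
    (fun j => ?_), Fintype.card_fin]
  rw [measureReal_def, measureReal_def]
  congr 1
  rw [Measure.map_apply (by fun_prop) measurableSet_Ioi]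
  exact (hid j).measure_mem_eq measurableSet_Ioi

/-! ### From tails to exponential moments -/

/-- The exponential moment of a measure on the line as an integral of its upper tails. -/
lemma lintegral_exp_mul_eq_lintegral_Ioi (μ : Measure ℝ) [SFinite μ] {t : ℝ} (ht : 0 < t) :
    ∫⁻ s, ENNReal.ofReal (Real.exp (t * s)) ∂μ =
      ∫⁻ x, ENNReal.ofReal (t * Real.exp (t * x)) * μ (Set.Ioi x) := by
  -- `exp (t * s)` is the integral of its derivative over `(-∞, s)`; Tonelli then exchanges `s` and
  -- `x`.
  have hinner : ∀ s : ℝ, ENNReal.ofReal (Real.exp (t * s)) =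
      ∫⁻ x, (Set.Iio s).indicator (fun x => ENNReal.ofReal (t * Real.exp (t * x))) x := by
    intro s
    rw [lintegral_indicator measurableSet_Iio, setLIntegral_congr Iio_ae_eq_Iic,
      ← ofReal_integral_eq_lintegral_ofReal ((integrableOn_exp_mul_Iic ht s).const_mul t)
        (ae_of_all _ fun x => by positivity), integral_const_mul, integral_exp_mul_Iic ht]
    congr 1
    field_simp
  have hmeas : Measurable fun p : ℝ × ℝ =>
      (Set.Iio p.1).indicator (fun x => ENNReal.ofReal (t * Real.exp (t * x))) p.2 := by
    have : (fun p : ℝ × ℝ =>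
        (Set.Iio p.1).indicator (fun x => ENNReal.ofReal (t * Real.exp (t * x))) p.2) =
        {p : ℝ × ℝ | p.2 < p.1}.indicator
          fun p => ENNReal.ofReal (t * Real.exp (t * p.2)) := by
      ext p; simp [Set.indicator]
    rw [this]
    exact Measurable.indicator (by fun_prop) (measurableSet_lt measurable_snd measurable_fst)
  simp_rw [hinner]
  rw [lintegral_lintegral_swap hmeas.aemeasurable]
  refine lintegral_congr fun x => ?_
  have : ∀ s : ℝ, (Set.Iio s).indicator (fun x => ENNReal.ofReal (t * Real.exp (t * x))) x =
      (Set.Ioi x).indicator (fun _ => ENNReal.ofReal (t * Real.exp (t * x))) s := by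
    intro s; simp [Set.indicator]
  simp_rw [this]
  rw [lintegral_indicator_const measurableSet_Ioi]

/-- Comparison of exponential moments of two measures whose upper tails are comparable on an
interval `[a, b]`. -/
lemma mgf_le_of_tail_le {μ ν : Measure ℝ} [IsProbabilityMeasure μ] [IsProbabilityMeasure ν]
    {l a b K : ℝ} (hl : 0 < l) (hK : 0 ≤ K)
    (hμ : ∀ s : ℝ, 0 ≤ s → s ≤ 2 * l → Integrable (fun x => Real.exp (s * x)) μ)
    (hν : Integrable (fun x => Real.exp (l * x)) ν)
    (h : ∀ x, a ≤ x → x ≤ b → μ.real (Set.Ioi x) ≤ K * ν.real (Set.Ioi x)) :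
    mgf id μ l ≤ K * mgf id ν l + 2 * Real.exp (l / 2 * a) * mgf id μ (l / 2) +
      Real.exp (-(l * b)) / 2 * mgf id μ (2 * l) := by
  have hL : ∀ (ρ : Measure ℝ) (s : ℝ), Integrable (fun x => Real.exp (s * x)) ρ →
      ENNReal.ofReal (mgf id ρ s) = ∫⁻ x, ENNReal.ofReal (Real.exp (s * x)) ∂ρ := fun ρ s hs =>
    ofReal_integral_eq_lintegral_ofReal hs (ae_of_all _ fun x => by positivity)
  have hn : ∀ (ρ : Measure ℝ) (s : ℝ), 0 ≤ mgf id ρ s := fun _ _ => mgf_nonneg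
  -- One term suffices on each range: below `a` use `exp (l * x) ≤ exp (l / 2 * a) * exp (l / 2 *
  -- x)`, above `b` use `exp (l * x) ≤ exp (-(l * b)) * exp (2 * l * x)`, in between use `h`. The
  -- factors `2` and `1 / 2` turn the weight `l` into the weights `l / 2` and `2 * l` of the moments
  -- at those points.
  have hpt : ∀ x : ℝ, ENNReal.ofReal (l * Real.exp (l * x)) * μ (Set.Ioi x) ≤
      ENNReal.ofReal K * (ENNReal.ofReal (l * Real.exp (l * x)) * ν (Set.Ioi x)) +
      ENNReal.ofReal (2 * Real.exp (l / 2 * a)) *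
        (ENNReal.ofReal (l / 2 * Real.exp (l / 2 * x)) * μ (Set.Ioi x)) +
      ENNReal.ofReal (Real.exp (-(l * b)) / 2) *
        (ENNReal.ofReal (2 * l * Real.exp (2 * l * x)) * μ (Set.Ioi x)) := by
    intro x
    rw [← ofReal_measureReal, ← ofReal_measureReal]
    rw [← ENNReal.ofReal_mul (by positivity), ← ENNReal.ofReal_mul (by positivity),
      ← ENNReal.ofReal_mul hK, ← ENNReal.ofReal_mul (by positivity),
      ← ENNReal.ofReal_mul (by positivity), ← ENNReal.ofReal_mul (by positivity),
      ← ENNReal.ofReal_mul (by positivity),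
      ← ENNReal.ofReal_add (by positivity) (by positivity),
      ← ENNReal.ofReal_add (by positivity) (by positivity)]
    apply ENNReal.ofReal_le_ofReal
    have hu : 0 ≤ μ.real (Set.Ioi x) := measureReal_nonneg
    have t1 : 0 ≤ K * (l * Real.exp (l * x) * ν.real (Set.Ioi x)) := by positivity
    have t2 : 0 ≤ 2 * Real.exp (l / 2 * a) *
        (l / 2 * Real.exp (l / 2 * x) * μ.real (Set.Ioi x)) := by positivity
    have t3 : 0 ≤ Real.exp (-(l * b)) / 2 *
        (2 * l * Real.exp (2 * l * x) * μ.real (Set.Ioi x)) := by positivity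
    rcases lt_or_ge x a with hxa | hxa
    · have hexp : Real.exp (l * x) ≤ Real.exp (l / 2 * a) * Real.exp (l / 2 * x) := by
        rw [← Real.exp_add, Real.exp_le_exp]; nlinarith
      have := mul_le_mul_of_nonneg_left hexp (mul_nonneg hl.le hu)
      nlinarith
    rcases lt_or_ge b x with hxb | hxb
    · have hexp : Real.exp (l * x) ≤ Real.exp (-(l * b)) * Real.exp (2 * l * x) := by
        rw [← Real.exp_add, Real.exp_le_exp]; nlinarith
      have := mul_le_mul_of_nonneg_left hexp (mul_nonneg hl.le hu)
      nlinarith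
    · have := mul_le_mul_of_nonneg_left (h x hxa hxb) (show 0 ≤ l * Real.exp (l * x) by positivity)
      nlinarith
  have key := lintegral_mono (μ := volume) hpt
  have hT : ∀ (ρ : Measure ℝ) (c s : ℝ),
      Measurable fun x : ℝ => ENNReal.ofReal (c * Real.exp (s * x)) * ρ (Set.Ioi x) :=
    fun ρ c s => (show Measurable fun x : ℝ => ENNReal.ofReal (c * Real.exp (s * x)) by
      fun_prop).mul (show Antitone fun x : ℝ => ρ (Set.Ioi x) from
        fun _ _ hxy => measure_mono (Set.Ioi_subset_Ioi hxy)).measurable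
  rw [lintegral_add_right _ ((hT _ _ _).const_mul _),
    lintegral_add_right _ ((hT _ _ _).const_mul _), lintegral_const_mul _ (hT _ _ _),
    lintegral_const_mul _ (hT _ _ _), lintegral_const_mul _ (hT _ _ _),
    ← lintegral_exp_mul_eq_lintegral_Ioi μ hl,
    ← lintegral_exp_mul_eq_lintegral_Ioi ν hl,
    ← lintegral_exp_mul_eq_lintegral_Ioi μ (by positivity : 0 < l / 2),
    ← lintegral_exp_mul_eq_lintegral_Ioi μ (by positivity : 0 < 2 * l),
    ← hL _ _ (hμ _ hl.le (by linarith)), ← hL _ _ hν, ← hL _ _ (hμ _ (by positivity) (by linarith)),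
    ← hL _ _ (hμ _ (by positivity) le_rfl), ← ENNReal.ofReal_mul hK,
    ← ENNReal.ofReal_mul (by positivity), ← ENNReal.ofReal_mul (by positivity)] at key
  have h1 := mul_nonneg hK (hn ν l)
  have h2 := mul_nonneg (show 0 ≤ 2 * Real.exp (l / 2 * a) by positivity) (hn μ (l / 2))
  have h3 := mul_nonneg (show 0 ≤ Real.exp (-(l * b)) / 2 by positivity) (hn μ (2 * l))
  rw [← ENNReal.ofReal_add h1 h2, ← ENNReal.ofReal_add (add_nonneg h1 h2) h3] at key
  exact (ENNReal.ofReal_le_ofReal_iff (add_nonneg (add_nonneg h1 h2) h3)).1 key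

lemma one_sub_one_sub_pow_le {p : ℝ} (hp : p ≤ 1) (d : ℕ) :
    1 - (1 - p) ^ d ≤ d * p := by
  have := one_add_mul_le_pow (a := -p) (by linarith) d
  rw [← sub_eq_add_neg] at this
  linarith

/-- The right side is `p` times the geometric sum of `(1 - p) ^ i` over `i < d`, and each term is at
least `(1 - p) ^ d ≥ 1 - d * p`. So the union bound loses at most a factor `1 - d * p`. -/
lemma mul_one_sub_le_one_sub_one_sub_pow {p : ℝ} (hp0 : 0 ≤ p) (hp : p ≤ 1) (d : ℕ) :
    d * p * (1 - d * p) ≤ 1 - (1 - p) ^ d := by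
  have hb : 1 - d * p ≤ (1 - p) ^ d := by linarith [one_sub_one_sub_pow_le hp d]
  have hsum : (d : ℝ) * (1 - p) ^ d ≤ ∑ i ∈ Finset.range d, (1 - p) ^ i := by
    have : ∀ i ∈ Finset.range d, (1 - p) ^ d ≤ (1 - p) ^ i := fun i hi =>
      pow_le_pow_of_le_one (by linarith) (by linarith) (Finset.mem_range.1 hi).le
    simpa using Finset.card_nsmul_le_sum _ _ _ this
  have hgeom := mul_neg_geom_sum (1 - p) d
  rw [← hgeom, sub_sub_cancel]
  calc d * p * (1 - d * p) ≤ d * p * (1 - p) ^ d := by gcongr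
    _ = p * (d * (1 - p) ^ d) := by ring
    _ ≤ _ := by gcongr

/-- If the maximum of `d` copies under `μ` has upper tails on `[l / 2, 2 * l]` dominated by
those under `ν`, then so has the exponential moment at `l`, up to a small error. -/
lemma mgf_le_of_max_tail_le {μ ν : Measure ℝ} [IsProbabilityMeasure μ] [IsProbabilityMeasure ν]
    {l K τ : ℝ} {d : ℕ} (hd : d ≠ 0) (hl : 0 < l) (hK : 0 ≤ K)
    (hμ : ∀ s : ℝ, 0 ≤ s → s ≤ 2 * l → Integrable (fun x => Real.exp (s * x)) μ)
    (hν : Integrable (fun x => Real.exp (l * x)) ν)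
    (hμ1 : mgf id μ (l / 2) ≤ Real.exp (l ^ 2 / 8 + 1))
    (hμ2 : mgf id μ (2 * l) ≤ Real.exp (2 * l ^ 2 + 1))
    (hτ : 9 * d * Real.exp (-(l ^ 2 / 8)) ≤ τ) (hτ1 : τ < 1)
    (h : ∀ x, l / 2 ≤ x → x ≤ 2 * l →
      1 - (1 - μ.real (Set.Ioi x)) ^ d ≤ K * (1 - (1 - ν.real (Set.Ioi x)) ^ d)) :
    mgf id μ l ≤ K / (1 - τ) * mgf id ν l + τ * Real.exp (l ^ 2 / 2) := by
  have he : Real.exp 1 ≤ 3 := by linarith [Real.exp_one_lt_d9]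
  have hd0 : (1 : ℝ) ≤ d := by exact_mod_cast Nat.one_le_iff_ne_zero.2 hd
  have hE := Real.exp_pos (-(l ^ 2 / 8))
  have hτ1' : 0 < 1 - τ := by linarith
  -- Chernoff's bound with parameter `l / 2`: for `x ≥ l / 2` the exponent is at most `-l ^ 2 / 4 +
  -- l ^ 2 / 8 + 1`.
  have htail : ∀ x, l / 2 ≤ x → d * μ.real (Set.Ioi x) ≤ τ := by
    intro x hx
    have hc : μ.real (Set.Ioi x) ≤ Real.exp (-(l / 2) * x) * mgf id μ (l / 2) :=
      (measureReal_mono (s₂ := {y | x ≤ id y}) (fun y (hy : x < y) => hy.le)).trans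
        (measure_ge_le_exp_mul_mgf (X := id) x (by positivity) (hμ _ (by positivity) (by linarith)))
    have h2 : Real.exp (-(l / 2) * x) * mgf id μ (l / 2) ≤ 3 * Real.exp (-(l ^ 2 / 8)) := by
      calc Real.exp (-(l / 2) * x) * mgf id μ (l / 2)
          ≤ Real.exp (-(l ^ 2 / 4)) * Real.exp (l ^ 2 / 8 + 1) := by
            gcongr
            · exact mgf_nonneg
            · nlinarith
        _ = Real.exp 1 * Real.exp (-(l ^ 2 / 8)) := by
            rw [← Real.exp_add, ← Real.exp_add]; congr 1; ring
        _ ≤ _ := by gcongr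
    calc d * μ.real (Set.Ioi x) ≤ d * (3 * Real.exp (-(l ^ 2 / 8))) := by gcongr; linarith
      _ ≤ 9 * d * Real.exp (-(l ^ 2 / 8)) := by nlinarith [mul_pos (by linarith : (0:ℝ) < d) hE]
      _ ≤ τ := hτ
  have hcmp : ∀ x, l / 2 ≤ x → x ≤ 2 * l →
      μ.real (Set.Ioi x) ≤ K / (1 - τ) * ν.real (Set.Ioi x) := by
    intro x hx1 hx2
    have hp0 : 0 ≤ μ.real (Set.Ioi x) := measureReal_nonneg
    have h1 := mul_one_sub_le_one_sub_one_sub_pow hp0 measureReal_le_one d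
    have h2 := one_sub_one_sub_pow_le (p := ν.real (Set.Ioi x)) measureReal_le_one d
    have h3 := h x hx1 hx2
    have h4 : d * μ.real (Set.Ioi x) * (1 - τ) ≤
        d * μ.real (Set.Ioi x) * (1 - d * μ.real (Set.Ioi x)) := by
      gcongr; exact htail x hx1
    have h5 := mul_le_mul_of_nonneg_left h2 hK
    have h6 : d * (μ.real (Set.Ioi x) * (1 - τ)) ≤ d * (K * ν.real (Set.Ioi x)) := by linarith
    rw [div_mul_eq_mul_div, le_div_iff₀ hτ1']
    exact le_of_mul_le_mul_left h6 (by linarith)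
  refine (mgf_le_of_tail_le hl (by positivity) hμ hν hcmp).trans ?_
  -- Relative to `exp (l ^ 2 / 2)`, the ranges below `l / 2` and above `2 * l` contribute at most `6
  -- * exp (-(l ^ 2 / 8))` and `3 * exp (-(l ^ 2 / 8))`; their sum gives the `9` in `hτ`.
  have b1 : 2 * Real.exp (l / 2 * (l / 2)) * mgf id μ (l / 2) ≤
      6 * Real.exp (-(l ^ 2 / 8)) * Real.exp (l ^ 2 / 2) := by
    calc 2 * Real.exp (l / 2 * (l / 2)) * mgf id μ (l / 2)
        ≤ 2 * Real.exp (l / 2 * (l / 2)) * Real.exp (l ^ 2 / 8 + 1) := by gcongr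
      _ = 2 * Real.exp 1 * (Real.exp (-(l ^ 2 / 8)) * Real.exp (l ^ 2 / 2)) := by
        rw [mul_assoc, mul_assoc, ← Real.exp_add, ← Real.exp_add, ← Real.exp_add]
        congr 2; ring
      _ ≤ 2 * 3 * (Real.exp (-(l ^ 2 / 8)) * Real.exp (l ^ 2 / 2)) := by gcongr
      _ = _ := by ring
  have b2 : Real.exp (-(l * (2 * l))) / 2 * mgf id μ (2 * l) ≤
      3 * Real.exp (-(l ^ 2 / 8)) * Real.exp (l ^ 2 / 2) := by
    calc Real.exp (-(l * (2 * l))) / 2 * mgf id μ (2 * l)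
        ≤ Real.exp (-(l * (2 * l))) / 2 * Real.exp (2 * l ^ 2 + 1) := by gcongr
      _ = Real.exp 1 / 2 := by
        rw [div_mul_eq_mul_div, ← Real.exp_add]; congr 2; ring
      _ ≤ 3 * 1 := by linarith
      _ ≤ 3 * (Real.exp (-(l ^ 2 / 8)) * Real.exp (l ^ 2 / 2)) := by
        rw [← Real.exp_add]; gcongr; exact Real.one_le_exp (by nlinarith [sq_nonneg l])
      _ = _ := by ring
  have b3 : 9 * Real.exp (-(l ^ 2 / 8)) * Real.exp (l ^ 2 / 2) ≤ τ * Real.exp (l ^ 2 / 2) := by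
    gcongr
    nlinarith
  linarith

/-- If the exponential moment of `μ` at `l` deviates from the Gaussian one, then the upper tails
of the maxima of `d` independent copies deviate somewhere on `[l / 2, 2 * l]`. -/
lemma exists_max_tail_deviation {μ : Measure ℝ} [IsProbabilityMeasure μ] {l u w : ℝ} {d : ℕ}
    (hd : d ≠ 0) (hl : 0 < l) (hu0 : 0 < u) (hu1 : u ≤ 1 / 10)
    (hμ : ∀ s : ℝ, 0 ≤ s → s ≤ 2 * l → Integrable (fun x => Real.exp (s * x)) μ)
    (hμ1 : mgf id μ (l / 2) ≤ Real.exp (l ^ 2 / 8 + 1))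
    (hμ2 : mgf id μ (2 * l) ≤ Real.exp (2 * l ^ 2 + 1))
    (hμl : |cgf id μ l - l ^ 2 / 2 - w| ≤ u) (hw : 16 * u ≤ |w|)
    (hτ : 9 * d * Real.exp (-(l ^ 2 / 8)) ≤ u) :
    ∃ x, l / 2 ≤ x ∧ x ≤ 2 * l ∧ u ≤ |(1 - (1 - μ.real (Set.Ioi x)) ^ d) /
      (1 - (1 - (gaussianReal 0 1).real (Set.Ioi x)) ^ d) - 1| := by
  by_contra! hcon
  have hg : ∀ s, mgf id (gaussianReal 0 1) s = Real.exp (s ^ 2 / 2) := by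
    intro s; rw [mgf_id_gaussianReal]; simp
  have hgi : ∀ s : ℝ, Integrable (fun x => Real.exp (s * x)) (gaussianReal 0 1) :=
    fun s => integrable_exp_mul_gaussianReal s
  have hmgf : mgf id μ l = Real.exp (cgf id μ l) :=
    (exp_cgf (X := id) (hμ l hl.le (by linarith))).symm
  -- A zero denominator would make the quotient `0` and the deviation `1`, which exceeds `u`.
  have hpos : ∀ x, l / 2 ≤ x → x ≤ 2 * l →
      0 < 1 - (1 - (gaussianReal 0 1).real (Set.Ioi x)) ^ d := by
    intro x h1 h2
    have h0 : 0 ≤ 1 - (1 - (gaussianReal 0 1).real (Set.Ioi x)) ^ d := by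
      have := pow_le_one₀ (n := d)
        (sub_nonneg.2 (measureReal_le_one (μ := gaussianReal 0 1) (s := Set.Ioi x)))
        (sub_le_self 1 measureReal_nonneg)
      linarith
    refine h0.lt_of_ne fun h => ?_
    have := hcon x h1 h2
    rw [← h] at this
    norm_num at this
    linarith
  have hE := Real.exp_pos (l ^ 2 / 2)
  rw [abs_le] at hμl
  -- If `w ≥ 0` the moment of `μ` is too large to be dominated by the Gaussian one with `K = 1 + u`;
  -- if `w ≤ 0` the roles are exchanged, with `K = 1 / (1 - u)`. In both cases the cumulant is off
  -- by at least `16 * u - u = 15 * u`, more than the comparison allows for `u ≤ 1 / 10`.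
  rcases le_total 0 w with hw0 | hw0
  · rw [abs_of_nonneg hw0] at hw
    have key := mgf_le_of_max_tail_le (ν := gaussianReal 0 1) (K := 1 + u) hd hl (by positivity) hμ
      (hgi l) hμ1 hμ2 hτ (by linarith) fun x h1 h2 => by
        have := (abs_lt.1 (hcon x h1 h2)).2
        rw [sub_lt_iff_lt_add, div_lt_iff₀ (hpos x h1 h2)] at this
        linarith
    rw [hg, hmgf] at key
    have h1 : Real.exp (l ^ 2 / 2) * (1 + 15 * u) ≤ Real.exp (cgf id μ l) := by
      calc Real.exp (l ^ 2 / 2) * (1 + 15 * u) ≤ Real.exp (l ^ 2 / 2) * Real.exp (15 * u) := by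
            gcongr; linarith [Real.add_one_le_exp (15 * u)]
        _ ≤ _ := by rw [← Real.exp_add]; gcongr; linarith
    have h2 : Real.exp (l ^ 2 / 2) * (1 + 15 * u) ≤
        Real.exp (l ^ 2 / 2) * ((1 + u) / (1 - u) + u) := by linarith
    have h3 : 1 + 15 * u ≤ (1 + u) / (1 - u) + u := le_of_mul_le_mul_left h2 hE
    have h4 : (1 + u) / (1 - u) ≤ 1 + 3 * u := by
      rw [div_le_iff₀ (by linarith)]; nlinarith
    linarith
  · rw [abs_of_nonpos hw0] at hw
    have key := mgf_le_of_max_tail_le (μ := gaussianReal 0 1) (ν := μ) (K := 1 / (1 - u)) hd hl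
      (by have : 0 < 1 - u := by linarith
          positivity) (fun s _ _ => hgi s) (hμ l hl.le (by linarith))
      (by rw [hg]; gcongr; nlinarith) (by rw [hg]; gcongr; nlinarith) hτ (by linarith)
      fun x h1 h2 => by
        have := (abs_lt.1 (hcon x h1 h2)).1
        rw [lt_sub_iff_add_lt, lt_div_iff₀ (hpos x h1 h2)] at this
        rw [one_div, inv_mul_eq_div, le_div_iff₀ (by linarith)]
        linarith
    rw [hg, hmgf] at key
    have h1 : Real.exp (cgf id μ l) * (1 + 15 * u) ≤ Real.exp (l ^ 2 / 2) := by
      calc Real.exp (cgf id μ l) * (1 + 15 * u) ≤ Real.exp (cgf id μ l) * Real.exp (15 * u) := by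
            gcongr; linarith [Real.add_one_le_exp (15 * u)]
        _ ≤ _ := by rw [← Real.exp_add]; gcongr; linarith
    have h2 : Real.exp (cgf id μ l) ≤ Real.exp (l ^ 2 / 2) / (1 + 15 * u) := by
      rwa [le_div_iff₀ (by linarith)]
    have h3 : Real.exp (l ^ 2 / 2) * 1 ≤ Real.exp (l ^ 2 / 2) *
        (1 / (1 - u) / (1 - u) * (1 / (1 + 15 * u)) + u) := by
      have hu : 0 ≤ 1 / (1 - u) / (1 - u) := by
        have : 0 < 1 - u := by linarith
        positivity
      have := mul_le_mul_of_nonneg_left h2 hu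
      calc _ ≤ _ := by linarith
        _ = 1 / (1 - u) / (1 - u) * (Real.exp (l ^ 2 / 2) / (1 + 15 * u)) +
          u * Real.exp (l ^ 2 / 2) := rfl
        _ = _ := by ring
    have h4 := le_of_mul_le_mul_left h3 hE
    have h5 : 1 - u ≤ 1 / ((1 - u) * (1 - u) * (1 + 15 * u)) := by
      have : 1 / ((1 - u) * (1 - u) * (1 + 15 * u)) =
        1 / (1 - u) / (1 - u) * (1 / (1 + 15 * u)) := by
          rw [div_div, div_mul_div_comm, one_mul]
      linarith
    have hu' : 0 < 1 - u := by linarith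
    rw [le_div_iff₀ (by positivity)] at h5
    nlinarith [mul_pos hu0 hu0, mul_pos hu0 (mul_pos hu0 hu0)]

/-! ### Cumulants of the normalized sum -/

/-- Exponential integrability makes `0` an interior point of the domain of the moment generating
function. -/
lemma eventually_integrable_exp_mul {Ω : Type*} [MeasurableSpace Ω] {P : Measure Ω}
    {Y : Ω → ℝ} (hY : Measurable Y) {c : ℝ} (hc : 0 < c)
    (hint : Integrable (fun ω => Real.exp (c * |Y ω|)) P) :
    ∀ᶠ t in 𝓝 (0 : ℝ), Integrable (fun ω => Real.exp (t * Y ω)) P := by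
  filter_upwards [Metric.ball_mem_nhds (0 : ℝ) hc] with t ht
  refine hint.mono' (by fun_prop) (ae_of_all _ fun ω => ?_)
  rw [Real.norm_eq_abs, Real.abs_exp, Real.exp_le_exp]
  rw [mem_ball_zero_iff, Real.norm_eq_abs] at ht
  calc t * Y ω ≤ |t * Y ω| := le_abs_self _
    _ = |t| * |Y ω| := abs_mul _ _
    _ ≤ _ := by gcongr

/-- Third-order expansion of the cumulant generating function of a standardized random variable. -/
lemma exists_abs_cgf_sub_le {Ω : Type*} [MeasurableSpace Ω] {P : Measure Ω}
    [IsProbabilityMeasure P] {Y : Ω → ℝ} {γ : ℝ}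
    (hint : ∀ᶠ t in 𝓝 (0 : ℝ), Integrable (fun ω => Real.exp (t * Y ω)) P)
    (hmean : ∫ ω, Y ω ∂P = 0) (hvar : ∫ ω, Y ω ^ 2 ∂P = 1) (hskew : ∫ ω, Y ω ^ 3 ∂P = γ) :
    ∃ B : ℝ, 0 < B ∧ ∀ᶠ t in 𝓝 (0 : ℝ), |cgf Y P t - t ^ 2 / 2 - γ * t ^ 3 / 6| ≤ B * t ^ 4 := by
  have h0 : (0 : ℝ) ∈ interior (integrableExpSet Y P) := mem_interior_iff_mem_nhds.2 hint
  obtain ⟨C, hC0, hC⟩ := ((hasFPowerSeriesAt_mgf h0).isBigO_sub_partialSum_pow 4).exists_pos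
  rw [isBigOWith_iff] at hC
  have hmgf : ∀ᶠ t in 𝓝 (0 : ℝ), |mgf Y P t - (1 + t ^ 2 / 2 + γ * t ^ 3 / 6)| ≤ C * t ^ 4 := by
    filter_upwards [hC] with t ht
    rw [zero_add, norm_pow, norm_norm, Real.norm_eq_abs, Real.norm_eq_abs,
      (by decide : Even 4).pow_abs] at ht
    convert ht using 3
    simp only [FormalMultilinearSeries.partialSum, Finset.sum_range_succ,
      FormalMultilinearSeries.ofScalars_apply_eq, zero_mul, Real.exp_zero, mul_one, hvar, hskew]
    simp [hmean, Nat.factorial]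
    ring
  set D : ℝ := 1 / 2 + |γ| / 6 + C with hD
  have hD0 : 0 < D := by positivity
  -- With `v = mgf Y P t - 1`, one has `|v| ≤ D * t ^ 2`, and `v - 2 * v ^ 2 ≤ log (1 + v) ≤ v` once
  -- `|v| ≤ 1 / 2`. Taking the logarithm thus adds at most `2 * D ^ 2 * t ^ 4` to the error.
  refine ⟨C + 2 * D ^ 2, by positivity, ?_⟩
  have hsmall : ∀ᶠ t in 𝓝 (0 : ℝ), |t| ≤ 1 ∧ D * t ^ 2 ≤ 1 / 2 := by
    have h1 : Tendsto (fun t : ℝ => |t|) (𝓝 0) (𝓝 0) := by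
      simpa using (continuous_abs (G := ℝ)).tendsto 0
    have h2 : Tendsto (fun t : ℝ => D * t ^ 2) (𝓝 0) (𝓝 0) := by
      simpa using (show Continuous fun t : ℝ => D * t ^ 2 by fun_prop).tendsto 0
    exact (h1.eventually_le_const one_pos).and (h2.eventually_le_const (by norm_num))
  filter_upwards [hmgf, hsmall] with t ht hs
  obtain ⟨v, hv⟩ : ∃ v, v = mgf Y P t - 1 := ⟨_, rfl⟩
  have hm : mgf Y P t = 1 + v := by linarith
  rw [cgf, hm]
  rw [hm] at ht
  have hvD : |v| ≤ D * t ^ 2 := by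
    have e1 : |γ * t ^ 3 / 6| ≤ |γ| / 6 * t ^ 2 := by
      rw [abs_div, abs_mul, abs_pow, abs_of_pos (by norm_num : (0 : ℝ) < 6), ← sq_abs t]
      have : |t| ^ 3 ≤ |t| ^ 2 := pow_le_pow_of_le_one (abs_nonneg t) hs.1 (by norm_num)
      have := mul_le_mul_of_nonneg_left this (abs_nonneg γ)
      linarith
    have e2 : C * t ^ 4 ≤ C * t ^ 2 := by
      have : |t| ^ 4 ≤ |t| ^ 2 := pow_le_pow_of_le_one (abs_nonneg t) hs.1 (by norm_num)
      rw [(by decide : Even 4).pow_abs, sq_abs] at this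
      gcongr
    rw [abs_le] at ht e1 ⊢
    have : D * t ^ 2 = 1 / 2 * t ^ 2 + |γ| / 6 * t ^ 2 + C * t ^ 2 := by rw [hD]; ring
    constructor <;> nlinarith [sq_nonneg t]
  have hv12 : |v| ≤ 1 / 2 := hvD.trans hs.2
  have hv2 : v ^ 2 ≤ D ^ 2 * t ^ 4 := by
    rw [← sq_abs]
    calc |v| ^ 2 ≤ (D * t ^ 2) ^ 2 := by gcongr
      _ = _ := by ring
  have hv12' := abs_le.1 hv12
  have hlog1 : Real.log (1 + v) ≤ v := by
    linarith [Real.log_le_sub_one_of_pos (show 0 < 1 + v by linarith)]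
  have hlog2 : v - 2 * v ^ 2 ≤ Real.log (1 + v) := by
    refine le_trans ?_ (Real.one_sub_inv_le_log_of_pos (show 0 < 1 + v by linarith))
    rw [le_sub_iff_add_le, ← le_sub_iff_add_le', inv_le_iff_one_le_mul₀ (by linarith)]
    nlinarith [sq_nonneg v]
  rw [abs_le] at ht ⊢
  constructor <;> nlinarith

/-- The cumulant generating function of the normalized sum. -/
lemma cgf_map_normalized_sum {Ω : Type*} [MeasurableSpace Ω] {P : Measure Ω}
    {Y : ℕ → Ω → ℝ} (hmeas : ∀ i, Measurable (Y i)) (hindep : iIndepFun Y P)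
    (hident : ∀ i, IdentDistrib (Y i) (Y 0) P P) (n : ℕ) (s : ℝ) :
    cgf id (P.map fun ω => (Real.sqrt n)⁻¹ * ∑ i ∈ Finset.range n, Y i ω) s =
      n * cgf (Y 0) P (s / Real.sqrt n) := by
  have h1 : mgf id (P.map fun ω => (Real.sqrt n)⁻¹ * ∑ i ∈ Finset.range n, Y i ω) s =
      mgf (∑ i ∈ Finset.range n, Y i) P (s / Real.sqrt n) := by
    rw [mgf_id_map (by fun_prop)]
    simp only [mgf, Finset.sum_apply]
    refine integral_congr_ae (ae_of_all _ fun ω => ?_)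
    simp only [div_eq_mul_inv, mul_assoc]
  rw [cgf, h1, hindep.mgf_sum hmeas, Finset.prod_congr rfl fun i _ =>
    mgf_congr_of_identDistrib (Y i) (Y 0) (hident i) _, Finset.prod_const, Finset.card_range,
    Real.log_pow, cgf]

lemma integrable_exp_mul_map_normalized_sum {Ω : Type*} [MeasurableSpace Ω] {P : Measure Ω}
    [IsProbabilityMeasure P] {Y : ℕ → Ω → ℝ} (hmeas : ∀ i, Measurable (Y i))
    (hindep : iIndepFun Y P) (hident : ∀ i, IdentDistrib (Y i) (Y 0) P P) (n : ℕ) (s : ℝ)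
    (hint : Integrable (fun ω => Real.exp (s / Real.sqrt n * Y 0 ω)) P) :
    Integrable (fun x => Real.exp (s * x))
      (P.map fun ω => (Real.sqrt n)⁻¹ * ∑ i ∈ Finset.range n, Y i ω) := by
  rw [integrable_map_measure (by fun_prop) (by fun_prop)]
  have := hindep.integrable_exp_mul_sum hmeas (s := Finset.range n) (t := s / Real.sqrt n)
    fun i _ => ((hident i).comp (u := fun y => Real.exp (s / Real.sqrt n * y))
      (by fun_prop)).integrable_iff.2 hint
  refine this.congr (ae_of_all _ fun ω => ?_)
  simp only [Function.comp_apply, Finset.sum_apply, div_eq_mul_inv, mul_assoc]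

/-! ### The choice of scale -/

/-- The scale `l` with `l ^ 12 = n * (√n + log (d n) ^ 3)`, which lies strictly between
`√(log (d n))` and `n ^ (1 / 6)` in order of magnitude. -/
noncomputable def deviationScale (d n : ℕ) : ℝ :=
  ((n : ℝ) * (Real.sqrt n + Real.log (d * n) ^ 3)) ^ (1 / 12 : ℝ)

lemma log_natCast_mul_nonneg (d n : ℕ) : 0 ≤ Real.log (d * n) := by
  rw [← Nat.cast_mul]; exact Real.log_natCast_nonneg _

lemma deviationScale_pow (d n : ℕ) :
    deviationScale d n ^ 12 = n * (Real.sqrt n + Real.log (d * n) ^ 3) := by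
  have := log_natCast_mul_nonneg d n
  rw [deviationScale, ← Real.rpow_natCast, ← Real.rpow_mul (by positivity)]
  norm_num

lemma deviationScale_nonneg (d n : ℕ) : 0 ≤ deviationScale d n := by
  have := log_natCast_mul_nonneg d n
  unfold deviationScale; positivity

/-- The logarithm splits as `log d + log n`, `(a + b) ^ 3 ≤ 4 * (a ^ 3 + b ^ 3)` for nonnegative
`a`, `b`, and both `√n` and `log n ^ 3` are `o(n)`. -/
lemma tendsto_sqrt_add_log_pow_div {d : ℕ → ℕ}
    (hd_small : Tendsto (fun n : ℕ => Real.log (d n) ^ 3 / n) atTop (𝓝 0)) :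
    Tendsto (fun n : ℕ => (Real.sqrt n + Real.log (d n * n) ^ 3) / n) atTop (𝓝 0) := by
  have h1 : Tendsto (fun n : ℕ => (Real.sqrt n)⁻¹) atTop (𝓝 0) :=
    (Real.tendsto_sqrt_atTop.comp tendsto_natCast_atTop_atTop).inv_tendsto_atTop
  have h2 : Tendsto (fun n : ℕ => Real.log n ^ 3 / n) atTop (𝓝 0) :=
    (Real.isLittleO_pow_log_id_atTop (n := 3)).tendsto_div_nhds_zero.comp
      tendsto_natCast_atTop_atTop
  have h3 := h1.add ((hd_small.add h2).const_mul 4)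
  simp only [add_zero, mul_zero] at h3
  refine tendsto_of_tendsto_of_tendsto_of_le_of_le' tendsto_const_nhds h3
    (Eventually.of_forall fun n => ?_) ?_
  · have := log_natCast_mul_nonneg (d n) n
    positivity
  filter_upwards [eventually_gt_atTop 0] with n hn
  have hn' : (0 : ℝ) < n := by exact_mod_cast hn
  have ha : 0 ≤ Real.log (d n) := Real.log_natCast_nonneg _
  have hb : 0 ≤ Real.log n := Real.log_natCast_nonneg _
  have hlog : Real.log (d n * n) ≤ Real.log (d n) + Real.log n := by
    rcases eq_or_ne (d n) 0 with h | h
    · simpa [h] using hb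
    · rw [Real.log_mul (by exact_mod_cast h) hn'.ne']
  have hcube : Real.log (d n * n) ^ 3 ≤ 4 * (Real.log (d n) ^ 3 + Real.log n ^ 3) := by
    calc _ ≤ (Real.log (d n) + Real.log n) ^ 3 :=
          pow_le_pow_left₀ (log_natCast_mul_nonneg _ _) hlog 3
      _ ≤ _ := by
        nlinarith [mul_nonneg (add_nonneg ha hb) (sq_nonneg (Real.log (d n) - Real.log n))]
  have hs : (Real.sqrt n)⁻¹ = Real.sqrt n / n := by
    rw [Real.sqrt_div_self]
  rw [hs, ← add_div, ← mul_div_assoc, ← add_div]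
  gcongr

/-- Everything follows from `L / n → 0`, where `L = √n + log (d n) ^ 3` and `l ^ 12 = n * L`: the
fourth power of `l ^ 3 / √n` and the twelfth power of `l / n ^ (1 / 6)` both equal `L / n`, while
`(l ^ 2) ^ 6 = n * L` eventually exceeds any multiple of `L ^ 2`. The bound with the exponential
makes the error of the union bound and of the truncated integral small against `l ^ 3 / √n`. -/
lemma eventually_deviationScale {d : ℕ → ℕ}
    (hd_small : Tendsto (fun n : ℕ => Real.log (d n) ^ 3 / n) atTop (𝓝 0))
    (hd : ∀ᶠ n in atTop, d n ≠ 0) {η : ℝ} (hη : 0 < η) :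
    ∀ᶠ n : ℕ in atTop, d n ≠ 0 ∧ 0 < n ∧ 1 ≤ deviationScale (d n) n ∧
      deviationScale (d n) n ^ 3 / Real.sqrt n ≤ η ∧
      9 * d n * Real.exp (-(deviationScale (d n) n ^ 2 / 8)) ≤
        η * (deviationScale (d n) n ^ 3 / Real.sqrt n) ∧
      deviationScale (d n) n ≤ η * (n : ℝ) ^ (1 / 6 : ℝ) ∧
      Real.log (d n * n) ^ 3 ≤ deviationScale (d n) n ^ 6 := by
  have hL := tendsto_sqrt_add_log_pow_div hd_small
  filter_upwards [hd, eventually_gt_atTop 0,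
    (tendsto_natCast_atTop_atTop (R := ℝ)).eventually_ge_atTop (9 / η),
    hL.eventually_le_const (show 0 < η ^ 4 by positivity),
    hL.eventually_le_const (show 0 < η ^ 12 by positivity),
    hL.eventually_le_const (show (0 : ℝ) < 1 / 24 ^ 6 by positivity)] with n hdn hn hnη h4 h12 h24
  have hl12 := deviationScale_pow (d n) n
  have hl0 := deviationScale_nonneg (d n) n
  have hg := log_natCast_mul_nonneg (d n) n
  set l := deviationScale (d n) n
  set g := Real.log (d n * n) with hgdef
  have hn1 : (1 : ℝ) ≤ n := by exact_mod_cast hn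
  have hn0 : (0 : ℝ) < n := by linarith
  have hd1 : (1 : ℝ) ≤ d n := by exact_mod_cast Nat.one_le_iff_ne_zero.2 hdn
  have hsq1 : 1 ≤ Real.sqrt n := Real.one_le_sqrt.2 hn1
  set L := Real.sqrt n + g ^ 3 with hLdef
  have hg3 : 0 ≤ g ^ 3 := by positivity
  have hL1 : 1 ≤ L := by linarith
  have hgL : g ^ 3 ≤ L := by linarith
  rw [div_le_iff₀ hn0] at h4 h12 h24
  have hl1 : 1 ≤ l := by
    rw [← one_le_pow_iff_of_nonneg hl0 (by norm_num : 12 ≠ 0), hl12]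
    nlinarith
  have hsq4 : Real.sqrt n ^ 4 = n ^ 2 := by
    rw [show 4 = 2 * 2 by norm_num, pow_mul, Real.sq_sqrt hn0.le]
  have hn6 : ((n : ℝ) ^ (1 / 6 : ℝ)) ^ 12 = n ^ 2 := by
    rw [← Real.rpow_natCast, ← Real.rpow_mul hn0.le, ← Real.rpow_natCast]
    norm_num
  have hL24 : 24 ^ 6 * L ^ 2 ≤ n * L := by nlinarith
  have hL2 : (g ^ 3) ^ 2 ≤ L ^ 2 := by gcongr
  refine ⟨hdn, hn, hl1, ?_, ?_, ?_, ?_⟩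
  · rw [← pow_le_pow_iff_left₀ (by positivity) hη.le (by norm_num : 4 ≠ 0), div_pow, hsq4,
      ← pow_mul, hl12, div_le_iff₀ (by positivity)]
    nlinarith
  -- Here `24 = 8 * 3`: it gives `exp (-(l ^ 2 / 8)) ≤ (d n * n) ^ (-3)`, so the left side is at
  -- most `9 / n ^ 2 ≤ η / n`.
  · have hlg : 24 * g ≤ l ^ 2 := by
      rw [← pow_le_pow_iff_left₀ (by positivity) (by positivity) (by norm_num : 6 ≠ 0), ← pow_mul,
        hl12]
      calc (24 * g) ^ 6 = 24 ^ 6 * (g ^ 3) ^ 2 := by ring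
        _ ≤ 24 ^ 6 * L ^ 2 := by gcongr
        _ ≤ _ := hL24
    have hexp : Real.exp (-(l ^ 2 / 8)) ≤ 1 / (d n * n) ^ 3 := by
      calc Real.exp (-(l ^ 2 / 8)) ≤ Real.exp (-(3 * g)) := by gcongr; linarith
        _ = 1 / (d n * n) ^ 3 := by
          rw [Real.exp_neg, one_div, mul_comm, hgdef, Real.exp_mul,
            Real.exp_log (by positivity)]
          norm_cast
    have hr : 1 / n ≤ l ^ 3 / Real.sqrt n := by
      have h1 : Real.sqrt n ≤ n := Real.sqrt_le_iff.2 ⟨hn0.le, by nlinarith⟩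
      have h2 : 1 ≤ l ^ 3 := one_le_pow₀ hl1
      gcongr
    rw [div_le_iff₀ hη] at hnη
    calc 9 * d n * Real.exp (-(l ^ 2 / 8)) ≤ 9 * d n * (1 / (d n * n) ^ 3) := by gcongr
      _ = 9 / ((d n : ℝ) ^ 2 * n ^ 3) := by field_simp
      _ ≤ 9 / (1 * n ^ 2) := by
        gcongr
        · exact one_le_pow₀ hd1
        · norm_num
      _ ≤ η * (1 / n) := by
        rw [div_le_iff₀ (by positivity)]
        field_simp
        linarith
      _ ≤ _ := by gcongr
  · rw [← pow_le_pow_iff_left₀ (by positivity) (by positivity) (by norm_num : 12 ≠ 0), mul_pow, hn6,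
      hl12]
    nlinarith
  · rw [← pow_le_pow_iff_left₀ (by positivity) (by positivity) (by norm_num : 2 ≠ 0),
      ← pow_mul l, hl12]
    nlinarith [sq_nonneg L]

/-! ### Deviation for the normalized sum -/

/-- On the scale `l`, the normalized sum of i.i.d. variables with third moment `γ` has maxima whose
upper tails deviate from the Gaussian ones by at least a multiple of `|γ| * l ^ 3 / √n`. -/
lemma exists_max_tail_deviation_normalized_sum {Ω : Type*} [MeasurableSpace Ω] {P : Measure Ω}
    [IsProbabilityMeasure P] {Y : ℕ → Ω → ℝ} {γ c : ℝ} {d : ℕ → ℕ}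
    (hmeas : ∀ i, Measurable (Y i)) (hindep : iIndepFun Y P)
    (hident : ∀ i, IdentDistrib (Y i) (Y 0) P P)
    (hc : 0 < c) (hint : Integrable (fun ω => Real.exp (c * |Y 0 ω|)) P)
    (hmean : ∫ ω, Y 0 ω ∂P = 0) (hvar : ∫ ω, Y 0 ω ^ 2 ∂P = 1) (hskew : ∫ ω, Y 0 ω ^ 3 ∂P = γ)
    (hγ : γ ≠ 0)
    (hd_small : Tendsto (fun n : ℕ => Real.log (d n) ^ 3 / n) atTop (𝓝 0))
    (hd : ∀ᶠ n in atTop, d n ≠ 0) :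
    ∀ᶠ n : ℕ in atTop, ∃ x, deviationScale (d n) n / 2 ≤ x ∧ x ≤ 2 * deviationScale (d n) n ∧
      |γ| / 100 * (deviationScale (d n) n ^ 3 / Real.sqrt n) ≤
        |(1 - (1 - (P.map fun ω => (Real.sqrt n)⁻¹ * ∑ i ∈ Finset.range n, Y i ω).real
            (Set.Ioi x)) ^ d n) /
          (1 - (1 - (gaussianReal 0 1).real (Set.Ioi x)) ^ d n) - 1| := by
  have hev := eventually_integrable_exp_mul (hmeas 0) hc hint
  obtain ⟨B, hB, hcgf⟩ := exists_abs_cgf_sub_le hev hmean hvar hskew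
  obtain ⟨δ, hδ, hball⟩ := Metric.eventually_nhds_iff.1 (hev.and hcgf)
  have hγ0 : 0 < |γ| := abs_pos.2 hγ
  -- `δ / 4` keeps all arguments `s / √n` with `s ≤ 2 * l` inside the expansion ball; `B * η ≤ |γ| /
  -- 100` puts the quartic error below `u`; the last two bounds keep the cumulants at `l / 2` and `2
  -- * l` within `1` of the Gaussian ones.
  obtain ⟨η, hη, hη1, hη2, hη3, hη4, hη5⟩ : ∃ η : ℝ, 0 < η ∧ η ≤ 1 ∧ η ≤ δ / 4 ∧
      B * η ≤ |γ| / 100 ∧ |γ| * η ≤ 1 / 4 ∧ 32 * B * η ≤ 1 := by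
    have hsmall : ∀ K ε : ℝ, 0 < ε → ∀ᶠ η in 𝓝[>] (0 : ℝ), K * η ≤ ε := fun K ε hε => by
      have : Tendsto (fun η : ℝ => K * η) (𝓝[>] 0) (𝓝 0) := by
        have h := (continuous_const_mul K).tendsto (0 : ℝ)
        rw [mul_zero] at h
        exact h.mono_left nhdsWithin_le_nhds
      exact this.eventually_le_const hε
    obtain ⟨η, h0, h1, h2, h3, h4, h5⟩ := ((eventually_mem_nhdsWithin (s := Set.Ioi (0 : ℝ))).and ((hsmall 1 1 one_pos).and
      ((hsmall 1 (δ / 4) (by positivity)).and ((hsmall B (|γ| / 100) (by positivity)).and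
      ((hsmall |γ| (1 / 4) (by norm_num)).and (hsmall (32 * B) 1 one_pos)))))).exists
    exact ⟨η, h0, by linarith, by linarith, h3, h4, h5⟩
  filter_upwards [eventually_deviationScale hd_small hd (η := min η (|γ| / 100)) (by positivity)]
    with n ⟨hdn, hn, hl1, hr, hτ, _, _⟩
  set l := deviationScale (d n) n
  have hn0 : (0 : ℝ) < n := by exact_mod_cast hn
  have hs0 : 0 < Real.sqrt n := Real.sqrt_pos.2 hn0
  have hss : Real.sqrt n ^ 2 = n := Real.sq_sqrt hn0.le
  have hl0 : 0 < l := by linarith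
  obtain ⟨r, hrdef⟩ : ∃ r, r = l ^ 3 / Real.sqrt n := ⟨_, rfl⟩
  rw [← hrdef] at hr hτ ⊢
  have hr0 : 0 < r := by rw [hrdef]; positivity
  have hrη : r ≤ η := hr.trans (min_le_left _ _)
  have hlr : l / Real.sqrt n ≤ r := by
    rw [hrdef]; gcongr; exact le_self_pow₀ hl1 (by norm_num)
  have ht : ∀ s, 0 ≤ s → s ≤ 2 * l → dist (s / Real.sqrt n) 0 < δ := by
    intro s hs0' hs
    rw [Real.dist_eq, sub_zero, abs_of_nonneg (by positivity)]
    calc s / Real.sqrt n ≤ 2 * l / Real.sqrt n := by gcongr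
      _ = 2 * (l / Real.sqrt n) := by ring
      _ < δ := by linarith
  set μ := P.map fun ω => (Real.sqrt n)⁻¹ * ∑ i ∈ Finset.range n, Y i ω
  have hμP : IsProbabilityMeasure μ := Measure.isProbabilityMeasure_map (by fun_prop)
  have hμ : ∀ s : ℝ, 0 ≤ s → s ≤ 2 * l → Integrable (fun x => Real.exp (s * x)) μ :=
    fun s h1 h2 => integrable_exp_mul_map_normalized_sum hmeas hindep hident n s
      (hball (ht s h1 h2)).1
  -- Used at `a = 1 / 2, 1, 2`. The error `a ^ 4 * B * l ^ 4 / n` is `a ^ 4 * B * r * (l / √n)`, and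
  -- `l / √n ≤ r` because `l ≥ 1`.
  have hexpand : ∀ a : ℝ, 0 ≤ a → a ≤ 2 →
      |cgf id μ (a * l) - a ^ 2 * l ^ 2 / 2 - a ^ 3 * (γ * r / 6)| ≤ a ^ 4 * (B * r ^ 2) := by
    intro a ha0 ha2
    have h := (hball (ht (a * l) (by positivity) (by gcongr))).2
    have hcg := cgf_map_normalized_sum hmeas hindep hident n (a * l)
    rw [hcg]
    have e : n * cgf (Y 0) P (a * l / Real.sqrt n) - a ^ 2 * l ^ 2 / 2 - a ^ 3 * (γ * r / 6) =
        n * (cgf (Y 0) P (a * l / Real.sqrt n) - (a * l / Real.sqrt n) ^ 2 / 2 -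
          γ * (a * l / Real.sqrt n) ^ 3 / 6) := by
      rw [hrdef]
      nth_rw 1 [← hss]
      nth_rw 4 [← hss]
      field_simp
    rw [e, abs_mul, abs_of_pos hn0]
    calc n * _ ≤ n * (B * (a * l / Real.sqrt n) ^ 4) := by gcongr
      _ = a ^ 4 * (B * (r * (l / Real.sqrt n))) := by
        rw [hrdef]
        nth_rw 1 [← hss]
        field_simp
      _ ≤ a ^ 4 * (B * (r * r)) := by gcongr
      _ = _ := by ring
  have hBr : B * r ^ 2 ≤ |γ| / 100 * r := by
    have : B * r ≤ |γ| / 100 := (by gcongr : B * r ≤ B * η).trans hη3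
    nlinarith
  have hBr' : 32 * (B * r ^ 2) ≤ 1 := by
    have h1 : 32 * B * r ≤ 1 := (by gcongr : 32 * B * r ≤ 32 * B * η).trans hη5
    have : 32 * B * r * r ≤ 1 * 1 := by gcongr; linarith
    linarith
  have hγr : |γ * r| ≤ 1 / 4 := by
    rw [abs_mul, abs_of_pos hr0]
    exact (by gcongr : |γ| * r ≤ |γ| * η).trans hη4
  have hγr' := abs_le.1 hγr
  -- Here `u = |γ| / 100 * r`; the demand `16 * u ≤ |w|` holds as `16 / 100 < 1 / 6`.
  refine exists_max_tail_deviation (w := γ * r / 6) hdn hl0 (by positivity) ?_ hμ ?_ ?_ ?_ ?_ ?_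
  · rw [abs_mul, abs_of_pos hr0] at hγr
    linarith
  · rw [← exp_cgf (X := id) (hμ (l / 2) (by positivity) (by linarith)), Real.exp_le_exp]
    have := (abs_le.1 (hexpand (1 / 2) (by norm_num) (by norm_num))).2
    rw [one_div, inv_mul_eq_div] at this
    linarith
  · rw [← exp_cgf (X := id) (hμ (2 * l) (by positivity) le_rfl), Real.exp_le_exp]
    have := (abs_le.1 (hexpand 2 (by norm_num) le_rfl)).2
    linarith
  · have := hexpand 1 (by norm_num) (by norm_num)
    simp only [one_pow, one_mul] at this
    linarith
  · rw [abs_div, abs_mul, abs_of_pos hr0, abs_of_pos (by norm_num : (0 : ℝ) < 6)]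
    nlinarith [mul_pos hγ0 hr0]
  · exact hτ.trans (by gcongr; exact min_le_right _ _)

/-! ### Conclusion -/

theorem mainTheorem10
    {Ω : Type*} [MeasurableSpace Ω] (P : Measure Ω) [IsProbabilityMeasure P]
    {Ω' : Type*} [MeasurableSpace Ω'] (P' : Measure Ω') [IsProbabilityMeasure P']
    (X : ℕ → ℕ → Ω → ℝ) (γ : ℝ) (d : ℕ → ℕ)
    (Z : (n : ℕ) → Ω' → EuclideanSpace ℝ (Fin (d n)))
    (hmeas : ∀ i j, Measurable (X i j))
    (hindep : iIndepFun (fun p : ℕ × ℕ => X p.1 p.2) P)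
    (hident : ∀ i j, IdentDistrib (X i j) (X 0 0) P P)
    (hexp : ∃ c : ℝ, 0 < c ∧ ∀ i j, Integrable (fun ω => Real.exp (c * |X i j ω|)) P)
    (hmean : ∀ i j, ∫ ω, X i j ω ∂P = 0)
    (hvar : ∀ i j, ∫ ω, X i j ω ^ 2 ∂P = 1)
    (hskew : ∀ i j, ∫ ω, X i j ω ^ 3 ∂P = γ)
    (hγ : γ ≠ 0)
    (hd_small : Tendsto (fun n : ℕ => Real.log (d n) ^ 3 / n) atTop (𝓝 0))
    (hd_large : Tendsto (fun n : ℕ => d n * Real.log (d n) ^ 3 / n) atTop atTop)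
    (hZ : ∀ n, HasLaw (Z n) (multivariateGaussian 0 1) P') :
    ∃ x : ℕ → ℝ, (∀ n, 0 < x n) ∧
      x =o[atTop] (fun n : ℕ => (n : ℝ) ^ (1 / 6 : ℝ)) ∧
      0 < limsup (fun n : ℕ =>
        ((Real.sqrt (n / (x n ^ 6 + Real.log (d n * n) ^ 3)) *
          |P.real {ω | x n < maxCoord (normalizedSum X n (d n) ω)} /
              P'.real {ω | x n < maxCoord (Z n ω)} - 1| : ℝ) : EReal)) atTop := by
  obtain ⟨c, hc, hint⟩ := hexp
  have hd : ∀ᶠ n in atTop, d n ≠ 0 := by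
    filter_upwards [hd_large.eventually_gt_atTop 0] with n hn h
    simp [h] at hn
  have hcol : iIndepFun (fun i => X i 0) P :=
    hindep.precomp (g := fun i => (i, 0)) fun a b hab => (Prod.ext_iff.1 hab).1
  have hdev := exists_max_tail_deviation_normalized_sum (fun i => hmeas i 0) hcol
    (fun i => hident i 0) hc (hint 0 0) (hmean 0 0) (hvar 0 0) (hskew 0 0) hγ hd_small hd
  have hγ0 : 0 < |γ| := abs_pos.2 hγ
  -- Positivity is required for every `n`, the deviation only for large `n`; where the latter is
  -- unavailable, the value `1` is taken.
  have hex : ∀ n : ℕ, ∃ x : ℝ, 0 < x ∧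
      ((d n ≠ 0 ∧ 0 < deviationScale (d n) n ∧
        ∃ x, deviationScale (d n) n / 2 ≤ x ∧ x ≤ 2 * deviationScale (d n) n ∧
        |γ| / 100 * (deviationScale (d n) n ^ 3 / Real.sqrt n) ≤
        |(1 - (1 - (P.map fun ω => (Real.sqrt n)⁻¹ * ∑ i ∈ Finset.range n, X i 0 ω).real
            (Set.Ioi x)) ^ d n) /
          (1 - (1 - (gaussianReal 0 1).real (Set.Ioi x)) ^ d n) - 1|) →
      x ≤ 2 * deviationScale (d n) n ∧
      |γ| / 100 * (deviationScale (d n) n ^ 3 / Real.sqrt n) ≤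
        |P.real {ω | x < maxCoord (normalizedSum X n (d n) ω)} /
          P'.real {ω | x < maxCoord (Z n ω)} - 1|) := by
    intro n
    by_cases h : d n ≠ 0 ∧ 0 < deviationScale (d n) n ∧
        ∃ x, deviationScale (d n) n / 2 ≤ x ∧ x ≤ 2 * deviationScale (d n) n ∧
        |γ| / 100 * (deviationScale (d n) n ^ 3 / Real.sqrt n) ≤
        |(1 - (1 - (P.map fun ω => (Real.sqrt n)⁻¹ * ∑ i ∈ Finset.range n, X i 0 ω).real
            (Set.Ioi x)) ^ d n) /
          (1 - (1 - (gaussianReal 0 1).real (Set.Ioi x)) ^ d n) - 1|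
    · obtain ⟨hdn, hl, x, hx1, hx2, hx3⟩ := h
      refine ⟨x, by linarith, fun _ => ⟨hx2, ?_⟩⟩
      rwa [measureReal_lt_maxCoord_normalizedSum hmeas hindep hident n hdn,
        measureReal_lt_maxCoord_gaussian hdn (hZ n)]
    · exact ⟨1, one_pos, fun h' => absurd h' h⟩
  choose x hx0 hx using hex
  have hev : ∀ᶠ n in atTop, x n ≤ 2 * deviationScale (d n) n ∧
      |γ| / 100 * (deviationScale (d n) n ^ 3 / Real.sqrt n) ≤
        |P.real {ω | x n < maxCoord (normalizedSum X n (d n) ω)} /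
          P'.real {ω | x n < maxCoord (Z n ω)} - 1| := by
    filter_upwards [hdev, eventually_deviationScale hd_small hd one_pos] with n h1 h2
    exact hx n ⟨h2.1, by linarith [h2.2.2.1], h1⟩
  refine ⟨x, hx0, ?_, ?_⟩
  · refine isLittleO_iff.2 fun ε hε => ?_
    filter_upwards [hev, eventually_deviationScale hd_small hd (half_pos hε)]
      with n h1 ⟨_, _, _, _, _, h2, _⟩
    rw [Real.norm_eq_abs, Real.norm_eq_abs, abs_of_pos (hx0 n), abs_of_nonneg (by positivity)]
    linarith [h1.1]
  · have hlow : ∀ᶠ n : ℕ in atTop, ((|γ| / 900 : ℝ) : EReal) ≤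
        ((Real.sqrt (n / (x n ^ 6 + Real.log (d n * n) ^ 3)) *
          |P.real {ω | x n < maxCoord (normalizedSum X n (d n) ω)} /
              P'.real {ω | x n < maxCoord (Z n ω)} - 1| : ℝ) : EReal) := by
      filter_upwards [hev, eventually_deviationScale hd_small hd one_pos]
        with n ⟨h1, h2⟩ ⟨_, hn, hl1, _, _, _, hlog⟩
      rw [EReal.coe_le_coe_iff]
      set l := deviationScale (d n) n
      have hn0 : (0 : ℝ) < n := by exact_mod_cast hn
      have hs0 : 0 < Real.sqrt n := Real.sqrt_pos.2 hn0
      have hl0 : 0 < l := by linarith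
      have hg := log_natCast_mul_nonneg (d n) n
      have hxn := hx0 n
      -- `2 ^ 6 + 1 = 65` is rounded up to the square `81 = 9 ^ 2`; with the `100` from `u` this
      -- gives the final constant `|γ| / 900`.
      have hsum : x n ^ 6 + Real.log (d n * n) ^ 3 ≤ 81 * l ^ 6 := by
        have : x n ^ 6 ≤ (2 * l) ^ 6 := by gcongr
        have : (2 * l) ^ 6 = 64 * l ^ 6 := by ring
        have : 0 < l ^ 6 := by positivity
        linarith
      have hsqrt : Real.sqrt n / (9 * l ^ 3) ≤
          Real.sqrt (n / (x n ^ 6 + Real.log (d n * n) ^ 3)) := by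
        apply Real.le_sqrt_of_sq_le
        rw [div_pow, Real.sq_sqrt hn0.le]
        have : (9 * l ^ 3) ^ 2 = 81 * l ^ 6 := by ring
        rw [this]
        gcongr
      calc |γ| / 900 = Real.sqrt n / (9 * l ^ 3) * (|γ| / 100 * (l ^ 3 / Real.sqrt n)) := by
            field_simp
            norm_num
        _ ≤ _ := by gcongr
    refine lt_of_lt_of_le ?_ (le_limsup_of_frequently_le hlow.frequently)
    exact_mod_cast (by positivity : (0 : ℝ) < |γ| / 900)
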